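/- Let $m\ge 1$ and $k\ge 0$ be integers. Let $\mathbb R_m$ be the real Clifford algebra generated by $e_1,\dots,e_m$ with $e_j^2=-1$ and $e_ie_j=-e_je_i$ for $i\ne j$. Let $\lambda\mapsto\bar\lambda$ be its real-linear anti-automorphism with $\overline{e_j}=-e_j$, let $[\lambda]_0$ denote the scalar part of $\lambda$, and put $|\lambda|^2=[\bar\lambda\lambda]_0$. For a differentiable function $f:\mathbb R^m\to\mathbb R$ let $\partial_x f=\sum_{j=1}^m e_j\,\frac{\partial f}{\partial x_j}$ be the Dirac operator, and for $F:\mathbb R^m\to\mathbb R_m$ let $\|F\|_{L^2(S^{m-1})}^2=\int_{S^{m-1}}|F(\omega)|^2\,d\omega$, where $d\omega$ is the surface measure on the unit sphere $S^{m-1}$ (counting measure on $S^0=\{\pm1\}$ if $m=1$). Let $\psi:\mathbb R^m\to\mathbb R$ be a real-valued spherical harmonic of degree $k$, that is, a harmonic function given by a homogeneous polynomial of degree $k$ with real coefficients (the zero function is allowed). Then $|\partial_x\psi|^2$ and $\psi^2$ are integrable over $S^{m-1}$ and $$\|\partial_x\psi\|_{L^2(S^{m-1})}^2=k(2k+m-2)\int_{S^{m-1}}\psi(\omega)^2\,d\omega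 .$$ -/

import Mathlib

open MeasureTheory

noncomputable section

/-- The standard negative definite form `v ↦ -(v₁² + ⋯ + vₘ²)` on `ℝᵐ`. -/
def negSq (m : ℕ) : QuadraticForm ℝ (Fin m → ℝ) :=
  QuadraticMap.weightedSumSquares ℝ (fun _ : Fin m => (-1 : ℝ))

/-- The real Clifford algebra `ℝₘ`, generated by `e₁, …, eₘ` with `eⱼ² = -1` and
`eᵢ eⱼ = -eⱼ eᵢ` for `i ≠ j`. -/
abbrev RealClifford (m : ℕ) : Type := CliffordAlgebra (negSq m)

namespace RealClifford

/-- The generator `eⱼ`. -/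
def gen {m : ℕ} (j : Fin m) : RealClifford m :=
  CliffordAlgebra.ι (negSq m) (Pi.single j 1)

/-- The scalar part `[a]₀`, i.e. the coefficient of `e_∅ = 1` of `a = ∑ A, a_A e_A`: the linear
isomorphism with the exterior algebra sends `e_A` (a product of orthogonal vectors) to the
corresponding wedge product, and `algebraMapInv` is the projection to degree `0` there. -/
def scalarPart {m : ℕ} (a : RealClifford m) : ℝ :=
  ExteriorAlgebra.algebraMapInv (CliffordAlgebra.equivExterior (negSq m) a)

/-- `|a|² = [ā a]₀`. Here `star` is Mathlib's Clifford conjugation, the real linear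
anti-automorphism with `star eⱼ = -eⱼ`. -/
def normSq {m : ℕ} (a : RealClifford m) : ℝ :=
  scalarPart (star a * a)

theorem gen_mul_self {m : ℕ} (j : Fin m) : gen j * gen j = (-1 : RealClifford m) := by
  have h : negSq m (Pi.single j 1) = -1 := by simp [negSq, Pi.single_apply]
  rw [gen, CliffordAlgebra.ι_sq_scalar, h, map_neg, map_one]

theorem gen_mul_gen {m : ℕ} {i j : Fin m} (h : i ≠ j) :
    gen i * gen j = -(gen j * gen i : RealClifford m) := by
  have hp : QuadraticMap.polar (negSq m) (Pi.single i 1) (Pi.single j 1) = 0 := by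
    simp only [QuadraticMap.polar, negSq, QuadraticMap.weightedSumSquares_apply, Pi.add_apply,
      ← Finset.sum_sub_distrib]
    refine Finset.sum_eq_zero fun l _ => ?_
    by_cases h1 : l = i
    · subst h1; simp [h]
    · simp [Pi.single_apply, h1]
  have := CliffordAlgebra.ι_mul_ι_add_swap (Q := negSq m) (Pi.single i 1) (Pi.single j 1)
  rw [hp, map_zero] at this
  exact eq_neg_of_add_eq_zero_left this

end RealClifford

/-- The Dirac operator `∂ₓ f = ∑ⱼ eⱼ ∂f/∂xⱼ` applied to a real-valued function `f` on `ℝᵐ`. -/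
def dirac {m : ℕ} (f : EuclideanSpace ℝ (Fin m) → ℝ) (x : EuclideanSpace ℝ (Fin m)) :
    RealClifford m :=
  ∑ j : Fin m, RealClifford.gen j *
    algebraMap ℝ (RealClifford m) (lineDeriv ℝ f x (EuclideanSpace.single j 1))

/-- The surface measure on the unit sphere `S^{m-1}` of `ℝᵐ`. -/
def sphereMeasure (m : ℕ) : Measure (Metric.sphere (0 : EuclideanSpace ℝ (Fin m)) 1) :=
  (volume : Measure (EuclideanSpace ℝ (Fin m))).toSphere

/-- The norm of `L²(S^{m-1})` for a Clifford-algebra-valued function, restricted to the sphere. -/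
def sphereL2Norm {m : ℕ} (F : EuclideanSpace ℝ (Fin m) → RealClifford m) : ℝ :=
  Real.sqrt (∫ ω : Metric.sphere (0 : EuclideanSpace ℝ (Fin m)) 1,
    RealClifford.normSq (F ω) ∂(sphereMeasure m))

/-- `ψ` is a real-valued spherical harmonic of degree `k` on `ℝᵐ`: a harmonic function that is
given by a homogeneous polynomial of degree `k`. -/
def IsSphericalHarmonic {m : ℕ} (k : ℕ) (ψ : EuclideanSpace ℝ (Fin m) → ℝ) : Prop :=
  (∃ p : MvPolynomial (Fin m) ℝ, p.IsHomogeneous k ∧ ∀ x, ψ x = MvPolynomial.eval (fun i => x i) p) ∧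
    InnerProductSpace.HarmonicOnNhd ψ Set.univ

end

/-! Since `dirac ψ` is vector-valued, its squared Clifford norm is |∇ψ|², so the claim concerns
∫|∇p|² over the sphere, where p is the polynomial of ψ. Both sides are compared through the Gaussian
weight e^{-|x|²} on ℝᵐ. Integrating p ∂ⱼp by parts and summing over j, harmonicity leaves |∇p|² on
one side and Euler's identity gives 2k p² on the other (`integral_eval_pderiv_mul_exp_neg_norm_sq`,
`sum_pderiv_mul_pderiv`). In polar coordinates a homogeneous integrand of degree n contributes its
sphere integral times Γ((m+n)/2)/2 (`integral_eval_mul_exp_neg_norm_sq`). The degrees 2k-2 and 2k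
differ by 2, so the Gamma quotient is (m+2k-2)/2, and 2k times it is k(2k+m-2). -/

theorem RealClifford.sum_gen_mul_algebraMap {m : ℕ} (c : Fin m → ℝ) :
    ∑ j, RealClifford.gen j * algebraMap ℝ (RealClifford m) (c j) =
      CliffordAlgebra.ι (negSq m) c := by
  conv_rhs => rw [pi_eq_sum_univ' c, map_sum]
  refine Finset.sum_congr rfl fun j _ => ?_
  rw [RealClifford.gen, map_smul, ← Algebra.commutes, Algebra.smul_def]

theorem RealClifford.scalarPart_algebraMap {m : ℕ} (r : ℝ) :
    RealClifford.scalarPart (algebraMap ℝ (RealClifford m) r) = r := by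
  rw [RealClifford.scalarPart, CliffordAlgebra.equivExterior, CliffordAlgebra.changeFormEquiv_apply,
    CliffordAlgebra.changeForm_algebraMap]
  exact ExteriorAlgebra.algebraMap_leftInverse _ r

/-- Conjugation negates a vector and the form is negative definite, so the two signs cancel. -/
theorem RealClifford.normSq_ι {m : ℕ} (c : Fin m → ℝ) :
    RealClifford.normSq (CliffordAlgebra.ι (negSq m) c) = ∑ j, c j ^ 2 := by
  rw [RealClifford.normSq, CliffordAlgebra.star_ι, neg_mul, CliffordAlgebra.ι_sq_scalar, ← map_neg,
    RealClifford.scalarPart_algebraMap]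
  simp [negSq, QuadraticMap.weightedSumSquares_apply, pow_two]

theorem normSq_dirac {m : ℕ} (f : EuclideanSpace ℝ (Fin m) → ℝ) (x : EuclideanSpace ℝ (Fin m)) :
    RealClifford.normSq (dirac f x) =
      ∑ j, lineDeriv ℝ f x (EuclideanSpace.single j 1) ^ 2 := by
  rw [dirac, RealClifford.sum_gen_mul_algebraMap, RealClifford.normSq_ι]

/-! ### Calculus of polynomial functions on Euclidean space. -/

namespace MvPolynomial

variable {m : ℕ}

theorem hasFDerivAt_eval_ofLp (p : MvPolynomial (Fin m) ℝ) (x : EuclideanSpace ℝ (Fin m)) :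
    HasFDerivAt (fun y : EuclideanSpace ℝ (Fin m) => eval y.ofLp p)
      (∑ j, eval x.ofLp (pderiv j p) • (EuclideanSpace.proj j : EuclideanSpace ℝ (Fin m) →L[ℝ] ℝ))
      x := by
  induction p using MvPolynomial.induction_on with
  | C a => simpa using hasFDerivAt_const a x
  | add p q hp hq =>
    simp only [map_add, add_smul, Finset.sum_add_distrib]
    exact hp.add hq
  | mul_X p i hp =>
    have h := hp.mul (EuclideanSpace.proj i : EuclideanSpace ℝ (Fin m) →L[ℝ] ℝ).hasFDerivAt (x := x)
    convert! h using 1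
    · ext y; simp
    · ext v
      simp only [Derivation.leibniz, pderiv_X, Pi.single_apply, smul_eq_mul, mul_ite, mul_one,
        mul_zero, map_add, map_mul, eval_X, apply_ite (eval x.ofLp), map_zero, ite_smul, zero_smul,
        add_smul, Finset.sum_add_distrib, Finset.sum_ite_eq, Finset.mem_univ, if_true, mul_smul,
        Finset.smul_sum]
      rfl

theorem hasLineDerivAt_eval_ofLp (p : MvPolynomial (Fin m) ℝ) (x : EuclideanSpace ℝ (Fin m))
    (j : Fin m) :
    HasLineDerivAt ℝ (fun y : EuclideanSpace ℝ (Fin m) => eval y.ofLp p)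
      (eval x.ofLp (pderiv j p)) x (EuclideanSpace.single j 1) := by
  simpa [Pi.single_apply] using
    (hasFDerivAt_eval_ofLp p x).hasLineDerivAt (EuclideanSpace.single j 1)

theorem continuous_eval_ofLp (p : MvPolynomial (Fin m) ℝ) :
    Continuous fun y : EuclideanSpace ℝ (Fin m) => eval y.ofLp p :=
  continuous_iff_continuousAt.2 fun x => (hasFDerivAt_eval_ofLp p x).continuousAt

theorem laplacian_eval_ofLp (p : MvPolynomial (Fin m) ℝ) (x : EuclideanSpace ℝ (Fin m)) :
    Laplacian.laplacian (fun y : EuclideanSpace ℝ (Fin m) => eval y.ofLp p) x =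
      eval x.ofLp (∑ j, pderiv j (pderiv j p)) := by
  rw [InnerProductSpace.laplacian_eq_iteratedFDeriv_orthonormalBasis _
    (EuclideanSpace.basisFun (Fin m) ℝ), map_sum]
  refine Finset.sum_congr rfl fun j _ => ?_
  have h1 : fderiv ℝ (fun y : EuclideanSpace ℝ (Fin m) => eval y.ofLp p) = fun y =>
      ∑ i, eval y.ofLp (pderiv i p) •
        (EuclideanSpace.proj i : EuclideanSpace ℝ (Fin m) →L[ℝ] ℝ) :=
    by ext1 y; exact (hasFDerivAt_eval_ofLp p y).fderiv
  have h2 : fderiv ℝ (fun y : EuclideanSpace ℝ (Fin m) => ∑ i, eval y.ofLp (pderiv i p) •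
      (EuclideanSpace.proj i : EuclideanSpace ℝ (Fin m) →L[ℝ] ℝ)) x =
      ∑ i, (∑ l, eval x.ofLp (pderiv l (pderiv i p)) •
        (EuclideanSpace.proj l : EuclideanSpace ℝ (Fin m) →L[ℝ] ℝ)).smulRight
        (EuclideanSpace.proj i : EuclideanSpace ℝ (Fin m) →L[ℝ] ℝ) :=
    (HasFDerivAt.fun_sum fun i _ => (hasFDerivAt_eval_ofLp (pderiv i p) x).smul_const _).fderiv
  rw [iteratedFDeriv_two_apply, h1, h2]
  simp

theorem eval_smul_ofLp {n : ℕ} {p : MvPolynomial (Fin m) ℝ} (hp : p.IsHomogeneous n) (r : ℝ)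
    (x : EuclideanSpace ℝ (Fin m)) : eval (r • x).ofLp p = r ^ n * eval x.ofLp p := by
  rw [eval_eq, eval_eq, Finset.mul_sum]
  refine Finset.sum_congr rfl fun d hd => ?_
  simp only [PiLp.smul_apply, smul_eq_mul, mul_pow, Finset.prod_mul_distrib,
    Finset.prod_pow_eq_pow_sum, hp.degree_eq_sum_deg_support hd]
  ring

theorem integrable_eval_sphere (p : MvPolynomial (Fin m) ℝ) :
    Integrable (fun ω : Metric.sphere (0 : EuclideanSpace ℝ (Fin m)) 1 => eval ω.1.ofLp p)
      (sphereMeasure m) := by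
  have : IsFiniteMeasure (sphereMeasure m) := by unfold sphereMeasure; infer_instance
  exact ((continuous_eval_ofLp p).comp continuous_subtype_val).integrable_of_hasCompactSupport
    (HasCompactSupport.of_compactSpace _)

end MvPolynomial

/-! ### Gaussian integrals in polar coordinates. -/

theorem hasLineDerivAt_exp_neg_norm_sq {m : ℕ} (x : EuclideanSpace ℝ (Fin m)) (j : Fin m) :
    HasLineDerivAt ℝ (fun y : EuclideanSpace ℝ (Fin m) => Real.exp (-‖y‖ ^ 2))
      (-(2 * x j) * Real.exp (-‖x‖ ^ 2)) x (EuclideanSpace.single j 1) := by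
  have h := ((hasStrictFDerivAt_norm_sq x).hasFDerivAt.neg.exp).hasLineDerivAt
    (EuclideanSpace.single j 1)
  convert! h using 1
  simp [EuclideanSpace.inner_single_right]
  ring

theorem integrable_volumeIoiPow_pow_mul_exp_neg_sq (d n : ℕ) :
    Integrable (fun r : Set.Ioi (0 : ℝ) => r.1 ^ n * Real.exp (-r.1 ^ 2))
      (Measure.volumeIoiPow d) := by
  rw [Measure.volumeIoiPow, integrable_withDensity_iff_integrable_smul' (by fun_prop) (by simp)]
  have h : IntegrableOn (fun r : ℝ => r ^ ((d + n : ℕ) : ℝ) * Real.exp (-1 * r ^ 2)) (Set.Ioi 0) :=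
    integrableOn_rpow_mul_exp_neg_mul_sq one_pos (by
      have : (0 : ℝ) ≤ ((d + n : ℕ) : ℝ) := Nat.cast_nonneg _
      linarith)
  rw [integrableOn_iff_comap_subtypeVal measurableSet_Ioi] at h
  refine h.congr (.of_forall ?_)
  rintro ⟨r, hr : 0 < r⟩
  simp only [Function.comp, Real.rpow_natCast, neg_mul, one_mul, smul_eq_mul, pow_add,
    ENNReal.toReal_ofReal (pow_nonneg hr.le _), mul_assoc]

theorem integral_volumeIoiPow_pow_mul_exp_neg_sq (d n : ℕ) :
    ∫ r : Set.Ioi (0 : ℝ), r.1 ^ n * Real.exp (-r.1 ^ 2) ∂(Measure.volumeIoiPow d) =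
      Real.Gamma (((d + n : ℕ) + 1 : ℝ) / 2) / 2 := by
  simp only [Measure.volumeIoiPow, ENNReal.ofReal]
  rw [integral_withDensity_eq_integral_smul (by fun_prop),
    integral_subtype_comap measurableSet_Ioi
      fun a : ℝ => Real.toNNReal (a ^ d) • (a ^ n * Real.exp (-a ^ 2))]
  have h := integral_rpow_mul_exp_neg_rpow (p := 2) (q := ((d + n : ℕ) : ℝ)) two_pos
    (by have : (0 : ℝ) ≤ ((d + n : ℕ) : ℝ) := Nat.cast_nonneg _
        linarith)
  rw [one_div_mul_eq_div] at h
  rw [← h]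
  refine setIntegral_congr_fun measurableSet_Ioi fun r hr => ?_
  simp only [NNReal.smul_def, Real.coe_toNNReal _ (pow_nonneg (le_of_lt hr) _), smul_eq_mul,
    Real.rpow_natCast, pow_add, mul_assoc, Real.rpow_two]

namespace MvPolynomial

variable {m n : ℕ} {p : MvPolynomial (Fin m) ℝ}

/-- Homogeneity separates the angular and radial variables, so Fubini applies on sphere × (0, ∞). -/
theorem IsHomogeneous.eval_mul_exp_neg_norm_sq_eq (hp : p.IsHomogeneous n)
    (x : ({0}ᶜ : Set (EuclideanSpace ℝ (Fin m)))) :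
    eval x.1.ofLp p * Real.exp (-‖x.1‖ ^ 2) =
      (fun z : Metric.sphere (0 : EuclideanSpace ℝ (Fin m)) 1 × Set.Ioi (0 : ℝ) =>
        eval z.1.1.ofLp p * (z.2.1 ^ n * Real.exp (-z.2.1 ^ 2)))
        (homeomorphUnitSphereProd (EuclideanSpace ℝ (Fin m)) x) := by
  have hx : x.1 ≠ 0 := x.2
  have h := eval_smul_ofLp hp ‖x.1‖ (‖x.1‖⁻¹ • x.1)
  rw [smul_inv_smul₀ (norm_ne_zero_iff.2 hx)] at h
  simp only [homeomorphUnitSphereProd_apply_fst_coe, homeomorphUnitSphereProd_apply_snd_coe]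
  rw [h]
  ring

theorem IsHomogeneous.integrable_eval_mul_exp_neg_norm_sq [NeZero m] (hp : p.IsHomogeneous n) :
    Integrable fun x : EuclideanSpace ℝ (Fin m) => eval x.ofLp p * Real.exp (-‖x‖ ^ 2) := by
  have h := (integrable_eval_sphere p).mul_prod
    (integrable_volumeIoiPow_pow_mul_exp_neg_sq
      (Module.finrank ℝ (EuclideanSpace ℝ (Fin m)) - 1) n)
  rw [sphereMeasure, ← ((volume : Measure (EuclideanSpace ℝ (Fin m))
    ).measurePreserving_homeomorphUnitSphereProd).integrable_comp_emb
    (Homeomorph.measurableEmbedding _)] at h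
  rw [← restrict_compl_singleton (μ := volume) (0 : EuclideanSpace ℝ (Fin m)), ← IntegrableOn,
    integrableOn_iff_comap_subtypeVal (measurableSet_singleton _).compl]
  exact h.congr (.of_forall fun x => (hp.eval_mul_exp_neg_norm_sq_eq x).symm)

theorem IsHomogeneous.integral_eval_mul_exp_neg_norm_sq [NeZero m] (hp : p.IsHomogeneous n) :
    ∫ x : EuclideanSpace ℝ (Fin m), eval x.ofLp p * Real.exp (-‖x‖ ^ 2) =
      (∫ ω : Metric.sphere (0 : EuclideanSpace ℝ (Fin m)) 1, eval ω.1.ofLp p ∂(sphereMeasure m)) *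
        (Real.Gamma ((m + n : ℝ) / 2) / 2) := by
  -- The radial density is r^(m-1); the truncated subtraction is harmless because m > 0.
  have hm : ((m - 1 + n : ℕ) : ℝ) + 1 = m + n := by
    have := NeZero.pos m
    rw [← Nat.cast_add_one, ← Nat.cast_add]
    congr 1
    omega
  have h : ∫ r : Set.Ioi (0 : ℝ), r.1 ^ n * Real.exp (-r.1 ^ 2)
      ∂(Measure.volumeIoiPow (Module.finrank ℝ (EuclideanSpace ℝ (Fin m)) - 1)) =
      Real.Gamma ((m + n : ℝ) / 2) / 2 := by
    rw [finrank_euclideanSpace_fin, ← hm]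
    exact integral_volumeIoiPow_pow_mul_exp_neg_sq (m - 1) n
  rw [← h, sphereMeasure, ← integral_prod_mul,
    ← ((volume : Measure (EuclideanSpace ℝ (Fin m))
    ).measurePreserving_homeomorphUnitSphereProd).integral_comp
    (Homeomorph.measurableEmbedding _)]
  rw [← integral_congr_ae (.of_forall hp.eval_mul_exp_neg_norm_sq_eq),
    integral_subtype_comap (measurableSet_singleton _).compl
      fun x : EuclideanSpace ℝ (Fin m) => eval x.ofLp p * Real.exp (-‖x‖ ^ 2),
    restrict_compl_singleton]

theorem integrable_eval_mul_exp_neg_norm_sq [NeZero m] (p : MvPolynomial (Fin m) ℝ) :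
    Integrable fun x : EuclideanSpace ℝ (Fin m) => eval x.ofLp p * Real.exp (-‖x‖ ^ 2) := by
  rw [← sum_homogeneousComponent p]
  simp only [map_sum, Finset.sum_mul]
  exact integrable_finsetSum _ fun i _ =>
    (homogeneousComponent_isHomogeneous i p).integrable_eval_mul_exp_neg_norm_sq

theorem integral_eval_pderiv_mul_exp_neg_norm_sq [NeZero m] (p : MvPolynomial (Fin m) ℝ)
    (j : Fin m) :
    ∫ x : EuclideanSpace ℝ (Fin m), eval x.ofLp (pderiv j p) * Real.exp (-‖x‖ ^ 2) =
      ∫ x : EuclideanSpace ℝ (Fin m), eval x.ofLp (2 * X j * p) * Real.exp (-‖x‖ ^ 2) := by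
  have h := integral_bilinear_hasLineDerivAt_right_eq_neg_left_of_integrable
    (μ := (volume : Measure (EuclideanSpace ℝ (Fin m)))) (B := ContinuousLinearMap.mul ℝ ℝ)
    (integrable_eval_mul_exp_neg_norm_sq (pderiv j p))
    ((integrable_eval_mul_exp_neg_norm_sq (-(2 * X j * p))).congr (.of_forall fun x => by
      change _ = eval x.ofLp p * (-(2 * x j) * Real.exp (-‖x‖ ^ 2))
      simp only [map_neg, map_mul, eval_X, map_ofNat]
      ring))
    (integrable_eval_mul_exp_neg_norm_sq p)
    (fun x _ => hasLineDerivAt_eval_ofLp p x j) (fun x _ => hasLineDerivAt_exp_neg_norm_sq x j)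
  rw [eq_neg_iff_add_eq_zero, add_comm, ← eq_neg_iff_add_eq_zero] at h
  refine h.trans ?_
  rw [← integral_neg]
  congr 1
  ext x
  simp only [ContinuousLinearMap.mul_apply', map_mul, eval_X, map_ofNat]
  ring

end MvPolynomial

/-! ### The gradient identity on the sphere. -/

namespace MvPolynomial

variable {m k : ℕ} {p : MvPolynomial (Fin m) ℝ}

theorem IsHomogeneous.sum_pderiv_mul_pderiv (hp : p.IsHomogeneous k)
    (h : ∑ j, pderiv j (pderiv j p) = 0) :
    ∑ j, pderiv j (p * pderiv j p) = ∑ j, pderiv j p ^ 2 ∧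
    ∑ j, 2 * X j * (p * pderiv j p) = C (2 * k : ℝ) * p ^ 2 := by
  constructor
  · simp only [Derivation.leibniz, smul_eq_mul, Finset.sum_add_distrib, ← Finset.mul_sum, h,
      mul_zero, zero_add, pow_two]
  · have he := hp.sum_X_mul_pderiv
    calc _ = 2 * p * ∑ j, X j * pderiv j p := by
          rw [Finset.mul_sum]
          exact Finset.sum_congr rfl fun j _ => by ring
      _ = _ := by
          rw [he, nsmul_eq_mul, map_mul, map_natCast, map_ofNat]
          ring

theorem IsHomogeneous.integral_sphere_sum_pderiv_sq (hp : p.IsHomogeneous k)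
    (h : ∑ j, pderiv j (pderiv j p) = 0) :
    ∫ ω : Metric.sphere (0 : EuclideanSpace ℝ (Fin m)) 1, eval ω.1.ofLp (∑ j, pderiv j p ^ 2)
        ∂(sphereMeasure m) =
      (k : ℝ) * (2 * (k : ℝ) + (m : ℝ) - 2) *
        ∫ ω : Metric.sphere (0 : EuclideanSpace ℝ (Fin m)) 1, eval ω.1.ofLp (p ^ 2)
          ∂(sphereMeasure m) := by
  -- For m = 0 the sphere is empty.
  obtain rfl | hm := eq_or_ne m 0
  · have : IsEmpty (Metric.sphere (0 : EuclideanSpace ℝ (Fin 0)) 1) :=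
      ⟨fun x => by simpa [Subsingleton.elim x.1 0] using x.2⟩
    simp only [integral_of_isEmpty, mul_zero]
  have : NeZero m := ⟨hm⟩
  -- For k = 0 the polynomial is constant. Otherwise k = l + 1, so |∇p|² has degree 2l and the Gamma
  -- argument (m+2l)/2 is positive.
  obtain _ | l := k
  · rw [← totalDegree_zero_iff_isHomogeneous, totalDegree_eq_zero_iff_eq_C] at hp
    rw [hp]
    simp
  have hA : (∑ j, pderiv j p ^ 2).IsHomogeneous (l * 2) :=
    IsHomogeneous.sum _ _ _ fun j _ => hp.pderiv.pow 2
  obtain ⟨h1, h2⟩ := hp.sum_pderiv_mul_pderiv h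
  have key : ∫ x : EuclideanSpace ℝ (Fin m),
        eval x.ofLp (∑ j, pderiv j p ^ 2) * Real.exp (-‖x‖ ^ 2) =
      ∫ x : EuclideanSpace ℝ (Fin m),
        eval x.ofLp (C (2 * (l + 1 : ℕ) : ℝ) * p ^ 2) * Real.exp (-‖x‖ ^ 2) := by
    rw [← h1, ← h2]
    simp only [map_sum, Finset.sum_mul]
    rw [integral_finsetSum _ fun j _ => MvPolynomial.integrable_eval_mul_exp_neg_norm_sq _,
      integral_finsetSum _ fun j _ => MvPolynomial.integrable_eval_mul_exp_neg_norm_sq _]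
    exact Finset.sum_congr rfl fun j _ => integral_eval_pderiv_mul_exp_neg_norm_sq _ j
  have hpos : (0 : ℝ) < (m + (l * 2 : ℕ)) / 2 := by
    have : (0 : ℝ) < m := Nat.cast_pos.2 (NeZero.pos m)
    positivity
  have hG : Real.Gamma ((m + ((l + 1) * 2 : ℕ)) / 2) =
      (m + (l * 2 : ℕ)) / 2 * Real.Gamma ((m + (l * 2 : ℕ)) / 2) := by
    rw [← Real.Gamma_add_one hpos.ne']
    congr 1
    push_cast
    ring
  simp only [map_mul, eval_C, mul_assoc] at key
  rw [integral_const_mul, integral_const_mul, hA.integral_eval_mul_exp_neg_norm_sq,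
    (hp.pow 2).integral_eval_mul_exp_neg_norm_sq, hG] at key
  have hG0 := (Real.Gamma_pos_of_pos hpos).ne'
  refine mul_right_cancel₀ (div_ne_zero hG0 two_ne_zero) (key.trans ?_)
  push_cast
  ring

end MvPolynomial

theorem mainTheorem2 (m k : ℕ) (ψ : EuclideanSpace ℝ (Fin m) → ℝ)
    (hψ : IsSphericalHarmonic k ψ) :
    Integrable (fun ω : Metric.sphere (0 : EuclideanSpace ℝ (Fin m)) 1 =>
        RealClifford.normSq (dirac ψ ω)) (sphereMeasure m) ∧
    Integrable (fun ω : Metric.sphere (0 : EuclideanSpace ℝ (Fin m)) 1 => ψ ω ^ 2)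
        (sphereMeasure m) ∧
    sphereL2Norm (dirac ψ) ^ 2 =
      (k : ℝ) * (2 * (k : ℝ) + (m : ℝ) - 2) *
        ∫ ω : Metric.sphere (0 : EuclideanSpace ℝ (Fin m)) 1, ψ ω ^ 2 ∂(sphereMeasure m) := by
  obtain ⟨⟨p, hp, hψp⟩, hharm⟩ := hψ
  obtain rfl : ψ = fun x => MvPolynomial.eval x.ofLp p := funext hψp
  -- A real polynomial vanishing at every point is zero, so harmonicity becomes an identity of
  -- polynomials.
  have hlap : ∑ j, MvPolynomial.pderiv j (MvPolynomial.pderiv j p) = 0 :=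
    MvPolynomial.funext fun x => by
      have h := (hharm (WithLp.toLp 2 x) (Set.mem_univ _)).2.eq_of_nhds
      rw [MvPolynomial.laplacian_eval_ofLp] at h
      simpa using h
  have hnorm (x : EuclideanSpace ℝ (Fin m)) :
      RealClifford.normSq (dirac (fun x => MvPolynomial.eval x.ofLp p) x) =
        MvPolynomial.eval x.ofLp (∑ j, MvPolynomial.pderiv j p ^ 2) := by
    simp only [normSq_dirac, (MvPolynomial.hasLineDerivAt_eval_ofLp p x _).lineDeriv, map_sum,
      map_pow]
  refine ⟨?_, ?_, ?_⟩
  · simp only [hnorm]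
    exact MvPolynomial.integrable_eval_sphere _
  · simp only [← map_pow]
    exact MvPolynomial.integrable_eval_sphere _
  · rw [sphereL2Norm, Real.sq_sqrt (integral_nonneg fun ω => ?_)]
    · simp only [hnorm, ← map_pow]
      exact hp.integral_sphere_sum_pderiv_sq hlap
    · simp only [Pi.zero_apply, normSq_dirac]
      positivity
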